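/- Let $G$ be a finite group acting linearly on $\mathbb{R}^n$ via $\varphi: G \to \mathrm{GL}_n(\mathbb{R})$. Write $\sigma(x)=\varphi(\sigma)x$ for variables, and let $G$ act on exponent vectors by the dual action $\sigma(\alpha)=\varphi(\sigma^{-1})^{T}\alpha$, so that $\langle \sigma(\alpha),x\rangle=\langle\alpha,\sigma^{-1}(x)\rangle$. For an exponent vector $\beta$ let $\mathrm{Stab}(\beta)=\{\sigma\in G:\sigma(\beta)=\beta\}$. Let $K\subset\mathbb{R}^n$ be convex and $G$-invariant. For finite $\mathcal{A}\subset\mathbb{R}^n$ and $\beta\notin\mathcal{A}$, let $C_K(\mathcal{A},\beta)$ be the set of all functions $\sum_{\alpha\in\mathcal{A}}c_\alpha e^{\langle\alpha,x\rangle}+c_\beta e^{\langle\beta,x\rangle}$ with $c_\alpha\ge 0$ for $\alpha\in\mathcal{A}$ and $c_\beta\in\mathbb{R}$ that are nonnegative on $K$. For disjoint finite $\mathcal{A},\mathcal{B}$, let $C_K(\mathcal{A},\mathcal{B})=\sum_{\beta\in\mathcal{B}}C_K(\mathcal{A},\beta)$ (Minkowski sum). For $\nu,\gamma\in\mathbb{R}_{\ge0}^{\mathcal{A}}$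 let $D(\nu,\gamma)=\sum_{\alpha\in\mathcal{A}}\nu_\alpha\ln(\nu_\alpha/\gamma_\alpha)\in\mathbb{R}\cup\{\infty\}$, with $0\ln(0/y)=0$ for $y\ge0$ and $y\ln(y/0)=\infty$ for $y>0$. Let $\mathcal{A},\mathcal{B}\subset\mathbb{R}^n$ be finite with $\mathcal{B}\neq\emptyset$, and let $$f(x)=\sum_{\alpha\in\mathcal{A}}c_\alpha e^{\langle\alpha,x\rangle}+\sum_{\beta\in\mathcal{B}}c_\beta e^{\langle\beta,x\rangle},\qquad c_\alpha>0\ (\alpha\in\mathcal{A}),\quad c_\beta<0\ (\beta\in\mathcal{B}),$$ be $G$-invariant, i.e. $f(\sigma^{-1}(x))=f(x)$ for all $\sigma\in G$, $x\in\mathbb{R}^n$ (in particular $\mathcal{A}\cap\mathcal{B}=\emptyset$, and $\mathcal{A}$ and $\mathcal{B}$ are $G$-invariant). Let $\hat{\mathcal{B}}\subset\mathcal{B}$ be a set of orbit representatives, i.e. an inclusion-minimal subset with $G\cdot\hat{\mathcal{B}}=\mathcal{B}$. For each $\hat\beta\in\hat{\mathcal{B}}$ fix any set $R_{\hat\beta}\subset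 G$ of representatives of the right cosets $\mathrm{Stab}(\hat\beta)\backslash G$. Then $f\in C_K(\mathcal{A},\mathcal{B})$ if and only if for every $\hat\beta\in\hat{\mathcal{B}}$ there exist $c^{(\hat\beta)},\nu^{(\hat\beta)}\in\mathbb{R}_{\ge0}^{\mathcal{A}}$ such that $$D(\nu^{(\hat\beta)},e\cdot c^{(\hat\beta)})+\sup_{x\in K}\Big\langle-\sum_{\alpha\in\mathcal{A}}\nu^{(\hat\beta)}_\alpha(\alpha-\hat\beta),\,x\Big\rangle\le c_{\hat\beta}\quad\text{for every }\hat\beta\in\hat{\mathcal{B}},$$ $$\sum_{\hat\beta\in\hat{\mathcal{B}}}\ \sum_{\sigma\in R_{\hat\beta}}c^{(\hat\beta)}_{\sigma(\alpha)}\le c_\alpha\quad\text{for every }\alpha\in\mathcal{A}$$ (where the supremum over $K=\emptyset$ is $-\infty$, and in that case the left-hand side of the first condition is read as $-\infty$). Moreover, if $f\in C_K(\mathcal{A},\mathcal{B})$, then $c^{(\hat\beta)}$ and $\nu^{(\hat\beta)}$ can be chosen invariant under $\mathrm{Stab}(\hat\beta)$, in which case the second sum does not depend on the choice of the $R_{\hat\beta}$.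 -/

import Mathlib

open scoped Pointwise

noncomputable section

namespace SymmSage

/-- Column vectors with the standard Euclidean inner product. -/
abbrev Vec (n : ℕ) := EuclideanSpace ℝ (Fin n)

variable {n : ℕ} {G : Type*} [Group G]

/-- The exponential sum `x ↦ ∑ α ∈ T, c α * exp ⟨α, x⟩` supported on `T`. -/
def signomial (T : Finset (Vec n)) (c : Vec n → ℝ) : Vec n → ℝ :=
  fun x => ∑ α ∈ T, c α * Real.exp (inner ℝ α x)

/-- The cone of `K`-AGE signomials: nonnegative on `K`, with nonnegative coefficients on `A`
and an arbitrary real coefficient at `β`. -/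
def ageCone (K : Set (Vec n)) (A : Finset (Vec n)) (β : Vec n) : Set (Vec n → ℝ) :=
  {f | ∃ (c : Vec n → ℝ) (b : ℝ), (∀ α ∈ A, 0 ≤ c α) ∧
    (f = fun x => signomial A c x + b * Real.exp (inner ℝ β x)) ∧
    ∀ x ∈ K, 0 ≤ f x}

/-- The signed `K`-SAGE cone: the Minkowski sum of the `K`-AGE cones over `β ∈ B`. -/
def sageCone (K : Set (Vec n)) (A B : Finset (Vec n)) : Set (Vec n → ℝ) :=
  ∑ β ∈ B, ageCone K A β

/-- One summand `a * log (a / b)` of the relative entropy for `a, b ≥ 0`, with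
`0 * log (0 / b) = 0` and `a * log (a / 0) = ∞` for `a > 0`. -/
def relEntropyTerm (a b : ℝ) : EReal :=
  if a = 0 then 0 else if b = 0 then ⊤ else ((a * Real.log (a / b) : ℝ) : EReal)

/-- The extended relative entropy function `D(ν, γ)` over the index set `A`. -/
def relEntropy (A : Finset (Vec n)) (ν γ : Vec n → ℝ) : EReal :=
  ∑ α ∈ A, relEntropyTerm (ν α) (γ α)

/-- The support function `sup_{x ∈ K} ⟨v, x⟩`, with values in `[-∞, ∞]`. -/
def supportFn (K : Set (Vec n)) (v : Vec n) : EReal :=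
  ⨆ x ∈ K, ((inner ℝ v x : ℝ) : EReal)

/-- The dual action of `G` on exponent vectors: `σ` acts by the adjoint of `φ σ⁻¹`. -/
def dualAct (φ : Representation ℝ G (Vec n)) : Representation ℝ G (Vec n) where
  toFun σ := LinearMap.adjoint (φ σ⁻¹)
  map_one' := by
    ext1 x
    refine ext_inner_right ℝ fun y => ?_
    simp
  map_mul' σ τ := by
    ext1 x
    refine ext_inner_right ℝ fun y => ?_
    simp [LinearMap.adjoint_inner_left]

/-- The stabilizer of an exponent vector under the dual action. -/
def stab (φ : Representation ℝ G (Vec n)) (β : Vec n) : Subgroup G where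
  carrier := {σ | dualAct φ σ β = β}
  one_mem' := by simp
  mul_mem' {σ τ} hσ hτ := by
    simp only [Set.mem_ofPred_eq] at hσ hτ ⊢
    rw [map_mul, Module.End.mul_apply, hτ, hσ]
  inv_mem' {σ} hσ := by
    simp only [Set.mem_ofPred_eq] at hσ ⊢
    calc dualAct φ σ⁻¹ β = dualAct φ σ⁻¹ (dualAct φ σ β) := by rw [hσ]
      _ = β := by rw [← Module.End.mul_apply, ← map_mul]; simp

/-- The orbit `G · S` of a set of exponent vectors. -/
def orbitSet (φ : Representation ℝ G (Vec n)) (S : Set (Vec n)) : Set (Vec n) :=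
  {α | ∃ σ : G, ∃ s ∈ S, dualAct φ σ s = α}

/-- `Shat` is an inclusion-minimal subset of `S` whose orbit is `S`. -/
def IsOrbitReps (φ : Representation ℝ G (Vec n)) (S Shat : Set (Vec n)) : Prop :=
  Minimal (fun T : Set (Vec n) => T ⊆ S ∧ orbitSet φ T = S) Shat

/-- The functions `γ β` and `ν β` (of which only the restrictions to `A` matter), for
`β ∈ Bhat`, satisfy the symmetry-reduced relative entropy conditions for the coefficients `c`.
For each `β`, the sum over the right cosets of the stabilizer of `β` runs over `R β`. -/
structure IsCertificate (φ : Representation ℝ G (Vec n)) (K : Set (Vec n))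
    (A Bhat : Finset (Vec n)) (c : Vec n → ℝ) (R : Vec n → Finset G)
    (γ ν : Vec n → Vec n → ℝ) : Prop where
  nonneg_coeff : ∀ β ∈ Bhat, ∀ α ∈ A, 0 ≤ γ β α
  nonneg_weight : ∀ β ∈ Bhat, ∀ α ∈ A, 0 ≤ ν β α
  entropy_le : ∀ β ∈ Bhat,
    relEntropy A (ν β) (fun α => Real.exp 1 * γ β α) +
      supportFn K (-∑ α ∈ A, ν β α • (α - β)) ≤ ((c β : ℝ) : EReal)
  coeff_le : ∀ α ∈ A, ∑ β ∈ Bhat, ∑ σ ∈ R β, γ β (dualAct φ σ α) ≤ c α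

/-- `γ β` and `ν β`, as functions on `A`, are invariant under the stabilizer of `β`. -/
def IsStabInvariant (φ : Representation ℝ G (Vec n)) (A Bhat : Finset (Vec n))
    (γ ν : Vec n → Vec n → ℝ) : Prop :=
  ∀ β ∈ Bhat, ∀ τ ∈ stab φ β, ∀ α ∈ A,
    γ β (dualAct φ τ α) = γ β α ∧ ν β (dualAct φ τ α) = ν β α

end SymmSage

end

/-!
The proof reduces the signed SAGE cone to coefficients and then uses two averaging arguments.

Exponentials with distinct exponents are linearly independent, being distinct monoid homomorphisms
(`signomial_coeff_unique`). Hence the invariance of `f` is invariance of `A`, `B` and `c`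
(`coeff_invariant`), and membership in the SAGE cone means that `c` on `A` can be split as
`∑ β ∈ B, C β` so that every `C β`, together with the coefficient `c β`, gives a signomial that is
nonnegative on `K` (`exists_coeff_of_mem_sageCone`, `mem_sageCone_of_coeff`).

Nonnegativity on `K` of one such AGE signomial is equivalent to the existence of weights `ν`
satisfying the relative entropy condition. Sufficiency is the Fenchel--Young inequality for `exp`
(`EntropyBound.nonneg`). For necessity (`exists_entropyBound`), a hyperplane separates the open
strict epigraph of `t ↦ ∑ i, γ i * exp (t i)` from the product of a half-line with the image
of `K` under `x ↦ (⟨α - β, x⟩)_α`; its slope is `ν`, and the conjugate of the sum of exponentials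
is the relative entropy with respect to `e * γ`. Openness of the epigraph makes closedness of `K` irrelevant.

Averaging the matrix `C` over `G` makes it equivariant (`exists_equivariant_coeff`), so that the
rows belonging to orbit representatives determine all others, and pairs consisting of an orbit
representative and a coset representative enumerate `B` (`sum_coset_reps`). By convexity of
`t ↦ t * log (t / k)`, the weights can be averaged over the stabilizer
(`exists_stab_invariant_weight`). Conversely, moving the rows of a certificate along the orbits
gives a decomposition of `f`, up to a nonnegative slack on `A` (`mem_sageCone_of_certificate`).
-/

namespace SymmSage

/-! ### Relative entropy duality for sums of exponentials -/

/-- Fenchel--Young inequality for the exponential. -/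
lemma mul_sub_mul_log_div_le_mul_exp {c ν t : ℝ} (hc : 0 ≤ c) (hν : 0 ≤ ν)
    (h : c = 0 → ν = 0) :
    ν * t - ν * Real.log (ν / (Real.exp 1 * c)) ≤ c * Real.exp t := by
  rcases hν.eq_or_lt with rfl | hν
  · simpa using mul_nonneg hc (Real.exp_pos t).le
  have hc : 0 < c := lt_of_le_of_ne hc fun h0 => hν.ne' (h h0.symm)
  rw [Real.log_div hν.ne' (by positivity), Real.log_mul (Real.exp_pos 1).ne' hc.ne', Real.log_exp]
  have key := Real.add_one_le_exp (t + Real.log c - Real.log ν)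
  rw [Real.exp_sub, Real.exp_add, Real.exp_log hc, Real.exp_log hν, le_div_iff₀ hν] at key
  nlinarith

lemma convexOn_mul_log_div (k : ℝ) :
    ConvexOn ℝ (Set.Ici 0) fun t : ℝ => t * Real.log (t / k) := by
  rcases eq_or_ne k 0 with rfl | hk
  · simpa using convexOn_const (0 : ℝ) (convex_Ici (0 : ℝ))
  have h : ConvexOn ℝ (Set.Ici 0) ((fun t : ℝ => t * Real.log t) + fun t => t * (-Real.log k)) :=
    Real.convexOn_mul_log.add ((LinearMap.mulRight ℝ (-Real.log k)).convexOn (convex_Ici 0))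
  refine h.congr fun t _ => ?_
  rcases eq_or_ne t 0 with rfl | ht
  · simp
  · simp only [Pi.add_apply, Real.log_div ht hk]
    ring

section StrongDuality

variable {ι : Type*} [Fintype ι] [DecidableEq ι] {c ν : ι → ℝ} {u : ℝ}

/-- If the conjugate of `t ↦ ∑ i, c i * exp (t i)` is finite at `ν`, then `ν` is nonnegative. -/
lemma nonneg_of_conjugate_le
    (h : ∀ t : ι → ℝ, ∑ i, ν i * t i - ∑ i, c i * Real.exp (t i) ≤ u) (i : ι) : 0 ≤ ν i := by
  by_contra! hi
  have h1 : Filter.Tendsto (fun M : ℝ => -ν i * M - c i * Real.exp (-M)) Filter.atTop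
      Filter.atTop := by
    have h2 : Filter.Tendsto (fun M : ℝ => -(c i * Real.exp (-M))) Filter.atTop (nhds 0) := by
      simpa using (Real.tendsto_exp_neg_atTop_nhds_zero.const_mul (c i)).neg
    simpa [sub_eq_add_neg] using
      (Filter.tendsto_id.const_mul_atTop (neg_pos.2 hi)).atTop_add h2
  obtain ⟨M, hM⟩ := (h1.eventually_gt_atTop (u + ∑ j ∈ Finset.univ.erase i, c j)).exists
  have h3 := h (Function.update 0 i (-M))
  rw [← Finset.add_sum_erase _ _ (Finset.mem_univ i),
    ← Finset.add_sum_erase _ (fun j => c j * _) (Finset.mem_univ i)] at h3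
  have h4 : ∑ j ∈ Finset.univ.erase i, ν j * Function.update (0 : ι → ℝ) i (-M) j = 0 :=
    Finset.sum_eq_zero fun j hj => by simp [Function.update_of_ne (Finset.ne_of_mem_erase hj)]
  have h5 : ∑ j ∈ Finset.univ.erase i, c j * Real.exp (Function.update (0 : ι → ℝ) i (-M) j) =
      ∑ j ∈ Finset.univ.erase i, c j :=
    Finset.sum_congr rfl fun j hj => by simp [Function.update_of_ne (Finset.ne_of_mem_erase hj)]
  rw [h4, h5, Function.update_self] at h3
  linarith

/-- If the conjugate of `t ↦ ∑ i, c i * exp (t i)` is finite at `ν`, then `ν` vanishes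
wherever `c` does. -/
lemma eq_zero_of_conjugate_le
    (h : ∀ t : ι → ℝ, ∑ i, ν i * t i - ∑ i, c i * Real.exp (t i) ≤ u) (i : ι) (hi : c i = 0) :
    ν i = 0 := by
  refine le_antisymm ?_ (nonneg_of_conjugate_le h i)
  by_contra! hpos
  have h3 := h (Function.update 0 i ((u + ∑ j, c j + 1) / ν i))
  have h4 : ∑ j, ν j * Function.update (0 : ι → ℝ) i ((u + ∑ j, c j + 1) / ν i) j =
      u + ∑ j, c j + 1 := by
    rw [Finset.sum_eq_single i (fun j _ hj => by simp [Function.update_of_ne hj]) (by simp),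
      Function.update_self]
    field_simp
  have h5 : ∑ j, c j * Real.exp (Function.update (0 : ι → ℝ) i ((u + ∑ j, c j + 1) / ν i) j) =
      ∑ j, c j := by
    refine Finset.sum_congr rfl fun j _ => ?_
    rcases eq_or_ne j i with rfl | hj
    · simp [hi]
    · simp [Function.update_of_ne hj]
  rw [h4, h5] at h3
  linarith

/-- The conjugate of `t ↦ ∑ i, c i * exp (t i)` at `ν` is at least the relative entropy of `ν`
with respect to `e * c`. -/
lemma sum_mul_log_div_le_of_conjugate_le (hc : ∀ i, 0 ≤ c i)
    (h : ∀ t : ι → ℝ, ∑ i, ν i * t i - ∑ i, c i * Real.exp (t i) ≤ u) :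
    ∑ i, ν i * Real.log (ν i / (Real.exp 1 * c i)) ≤ u := by
  -- The supremum is approached along `t i = log (ν i / c i)` where `ν i ≠ 0` and `t i → -∞`
  -- elsewhere.
  have hlim : Filter.Tendsto (fun M : ℝ => ∑ i, (ν i * Real.log (ν i / (Real.exp 1 * c i)) -
      if ν i = 0 then c i * Real.exp (-M) else 0)) Filter.atTop
      (nhds (∑ i, (ν i * Real.log (ν i / (Real.exp 1 * c i)) - 0))) := by
    refine tendsto_finsetSum _ fun i _ => tendsto_const_nhds.sub ?_
    split_ifs
    · simpa using Real.tendsto_exp_neg_atTop_nhds_zero.const_mul (c i)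
    · exact tendsto_const_nhds
  simp only [sub_zero] at hlim
  refine le_of_tendsto hlim (Filter.Eventually.of_forall fun M => ?_)
  refine le_of_eq_of_le ?_ (h fun i => if ν i = 0 then -M else Real.log (ν i / c i))
  rw [← Finset.sum_sub_distrib]
  refine Finset.sum_congr rfl fun i _ => ?_
  by_cases hi : ν i = 0
  · simp [hi]
  · have hν : 0 < ν i := (nonneg_of_conjugate_le h i).lt_of_ne' hi
    have hci : 0 < c i := (hc i).lt_of_ne' fun h0 => hi (eq_zero_of_conjugate_le h i h0)
    simp only [hi, if_false]
    rw [Real.exp_log (by positivity), Real.log_div hi (by positivity),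
      Real.log_mul (Real.exp_pos 1).ne' hci.ne', Real.log_exp, Real.log_div hi hci.ne']
    field_simp
    ring

/-- Strong duality: a sum of exponentials bounded below on a convex set admits
a relative entropy certificate for this bound. -/
lemma exists_entropy_certificate (hc : ∀ i, 0 ≤ c i) {C : Set (ι → ℝ)} (hC : Convex ℝ C)
    (hne : C.Nonempty) {b : ℝ} (h : ∀ t ∈ C, 0 ≤ ∑ i, c i * Real.exp (t i) + b) :
    ∃ ν : ι → ℝ, (∀ i, 0 ≤ ν i) ∧ (∀ i, c i = 0 → ν i = 0) ∧
      ∀ t ∈ C, ∑ i, ν i * Real.log (ν i / (Real.exp 1 * c i)) - ∑ i, ν i * t i ≤ b := by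
  have hconv : ConvexOn ℝ Set.univ fun t : ι → ℝ => ∑ i, c i * Real.exp (t i) := by
    refine ⟨convex_univ, fun x _ y _ a b ha hb hab => ?_⟩
    simp only [smul_eq_mul, Finset.mul_sum, ← Finset.sum_add_distrib]
    refine Finset.sum_le_sum fun i _ => ?_
    have := mul_le_mul_of_nonneg_left
      (convexOn_exp.2 (Set.mem_univ (x i)) (Set.mem_univ (y i)) ha hb hab) (hc i)
    simp only [smul_eq_mul, Pi.add_apply, Pi.smul_apply] at this ⊢
    linarith
  have hopen : IsOpen {p : (ι → ℝ) × ℝ | p.1 ∈ Set.univ ∧ ∑ i, c i * Real.exp (p.1 i) < p.2} := by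
    simp only [Set.mem_univ, true_and]
    exact isOpen_lt (by fun_prop) (by fun_prop)
  -- Separate the open strict epigraph from the convex set `C × (-∞, -b]`.
  obtain ⟨l, u, hl, hu⟩ := geometric_hahn_banach_open hconv.convex_strict_epigraph hopen
    (hC.prod (convex_Iic (-b))) (by
      rw [Set.disjoint_left]
      rintro ⟨t, s⟩ ⟨-, h1⟩ ⟨h2, h3⟩
      have := h t h2
      simp only [Set.mem_Iic] at h1 h3
      linarith)
  set w : ι → ℝ := fun i => l (Pi.single i 1, 0) with hw
  set k : ℝ := l (0, 1) with hk
  have hform : ∀ (t : ι → ℝ) (s : ℝ), l (t, s) = ∑ i, w i * t i + k * s := by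
    intro t s
    have h1 : ((t, s) : (ι → ℝ) × ℝ) =
        ∑ i, t i • ((Pi.single i 1, 0) : (ι → ℝ) × ℝ) + s • ((0, 1) : (ι → ℝ) × ℝ) := by
      ext i
      · simp [Prod.fst_sum, Finset.sum_apply, Pi.single_apply]
      · simp [Prod.snd_sum]
    rw [h1, map_add, map_sum, map_smul]
    simp only [map_smul, smul_eq_mul, hw, hk, mul_comm]
  have hl' : ∀ (t : ι → ℝ) (s : ℝ), ∑ i, c i * Real.exp (t i) < s →
      ∑ i, w i * t i + k * s < u := fun t s hts => hform t s ▸ hl (t, s) ⟨trivial, hts⟩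
  have hu' : ∀ t ∈ C, ∀ s ≤ -b, u ≤ ∑ i, w i * t i + k * s :=
    fun t ht s hs => hform t s ▸ hu (t, s) ⟨ht, hs⟩
  -- Comparing both sides above a point of `C` shows that the hyperplane is not vertical.
  obtain ⟨t₀, ht₀⟩ := hne
  have hk0 : k < 0 := by
    have h1 := hl' t₀ (∑ i, c i * Real.exp (t₀ i) + 1) (by linarith)
    have h2 := hu' t₀ ht₀ (-b) le_rfl
    have h3 := h t₀ ht₀
    by_contra! hk1
    nlinarith
  have hconj : ∀ t : ι → ℝ, ∑ i, w i / -k * t i - ∑ i, c i * Real.exp (t i) ≤ u / -k := by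
    intro t
    refine le_of_forall_pos_le_add fun ε hε => ?_
    have h1 := hl' t (∑ i, c i * Real.exp (t i) + ε) (by linarith)
    have h2 : ∑ i, w i / -k * t i = (∑ i, w i * t i) / -k := by
      rw [Finset.sum_div]
      exact Finset.sum_congr rfl fun i _ => by ring
    rw [h2, sub_le_iff_le_add, ← sub_nonneg]
    have hk' : k ≠ 0 := hk0.ne
    have h3 : u / -k + ε + ∑ i, c i * Real.exp (t i) - (∑ i, w i * t i) / -k =
        (u - (∑ i, w i * t i + k * (∑ i, c i * Real.exp (t i) + ε))) / -k := by
      field_simp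
      ring
    rw [h3]
    exact div_nonneg (by linarith) (by linarith)
  refine ⟨fun i => w i / -k, nonneg_of_conjugate_le hconj, eq_zero_of_conjugate_le hconj,
    fun t ht => ?_⟩
  have h1 := sum_mul_log_div_le_of_conjugate_le hc hconj
  have h2 := hu' t ht (-b) le_rfl
  have h3 : ∑ i, w i / -k * t i = (∑ i, w i * t i) / -k := by
    rw [Finset.sum_div]
    exact Finset.sum_congr rfl fun i _ => by ring
  have h4 : u / -k ≤ (∑ i, w i * t i) / -k + b := by
    rw [div_add' _ _ _ (by linarith : -k ≠ 0)]
    exact div_le_div_of_nonneg_right (by linarith) (by linarith)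
  rw [h3]
  linarith

end StrongDuality

/-! ### Linear independence of exponentials and the signed SAGE cone -/

section Cone

variable {n : ℕ}

/-- The exponential `x ↦ exp ⟨α, x⟩` as a monoid homomorphism. -/
noncomputable def expHom (α : Vec n) : Multiplicative (Vec n) →* ℝ where
  toFun x := Real.exp (inner ℝ α x.toAdd)
  map_one' := by simp
  map_mul' x y := by simp [inner_add_right, Real.exp_add]

lemma expHom_injective : Function.Injective (expHom (n := n)) := by
  intro α β h
  refine ext_inner_right ℝ fun y => Real.exp_injective ?_
  exact DFunLike.congr_fun h (Multiplicative.ofAdd y)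

lemma signomial_coeff_unique {T : Finset (Vec n)} {c d : Vec n → ℝ}
    (h : ∀ x, signomial T c x = signomial T d x) : ∀ α ∈ T, c α = d α := by
  have hli := (linearIndependent_monoidHom (Multiplicative (Vec n)) ℝ).comp _
    (expHom_injective (n := n))
  intro α hα
  refine sub_eq_zero.1 (linearIndependent_iff'.1 hli T (fun α => c α - d α) ?_ α hα)
  funext x
  have := h x.toAdd
  simp only [signomial] at this
  simp only [Finset.sum_apply, Pi.smul_apply, Function.comp_apply, smul_eq_mul, sub_mul,
    Finset.sum_sub_distrib, Pi.zero_apply]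
  exact sub_eq_zero.2 this

lemma signomial_add_signomial [DecidableEq (Vec n)] {A B : Finset (Vec n)} (hAB : Disjoint A B)
    (c d : Vec n → ℝ) (x : Vec n) :
    signomial A c x + signomial B d x =
      signomial (A ∪ B) (fun α => if α ∈ A then c α else d α) x := by
  simp only [signomial, Finset.sum_union hAB]
  congr 1
  · exact Finset.sum_congr rfl fun α hα => by rw [if_pos hα]
  · exact Finset.sum_congr rfl fun α hα => by rw [if_neg (Finset.disjoint_right.1 hAB hα)]

lemma signomial_add_coeff_unique {A B : Finset (Vec n)} (hAB : Disjoint A B)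
    {c d c' d' : Vec n → ℝ}
    (h : ∀ x, signomial A c x + signomial B d x = signomial A c' x + signomial B d' x) :
    (∀ α ∈ A, c α = c' α) ∧ ∀ β ∈ B, d β = d' β := by
  classical
  simp only [signomial_add_signomial hAB] at h
  have key := signomial_coeff_unique h
  refine ⟨fun α hα => ?_, fun β hβ => ?_⟩
  · simpa [hα] using key α (Finset.mem_union_left _ hα)
  · simpa [Finset.disjoint_right.1 hAB hβ] using key β (Finset.mem_union_right _ hβ)

variable {K : Set (Vec n)} {A B : Finset (Vec n)} {c : Vec n → ℝ}

/-- A decomposition into AGE signomials splits the positive coefficients and leaves the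
negative ones untouched. -/
lemma exists_coeff_of_mem_sageCone (hAB : Disjoint A B)
    (h : (fun x => signomial A c x + signomial B c x) ∈ sageCone K A B) :
    ∃ C : Vec n → Vec n → ℝ, (∀ β ∈ B, ∀ α ∈ A, 0 ≤ C β α) ∧
      (∀ α ∈ A, ∑ β ∈ B, C β α = c α) ∧
      ∀ β ∈ B, ∀ x ∈ K, 0 ≤ signomial A (C β) x + c β * Real.exp (inner ℝ β x) := by
  obtain ⟨g, hg, hsum⟩ := (Set.mem_finsetSum _ _ _).1 h
  choose! C b hC hgC hnn using fun β (hβ : β ∈ B) => hg hβ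
  have huniq := signomial_add_coeff_unique (c := c) (d := c) (c' := fun α => ∑ β ∈ B, C β α)
    (d' := b) hAB fun x => by
      rw [← congrFun hsum x, Finset.sum_apply]
      simp only [signomial, Finset.sum_mul]
      rw [Finset.sum_comm, ← Finset.sum_add_distrib]
      exact Finset.sum_congr rfl fun β hβ => congrFun (hgC β hβ) x
  refine ⟨C, hC, fun α hα => (huniq.1 α hα).symm, fun β hβ x hx => ?_⟩
  have := hnn β hβ x hx
  rw [hgC β hβ] at this
  rwa [huniq.2 β hβ]

lemma mem_sageCone_of_coeff (hB : B.Nonempty) {C : Vec n → Vec n → ℝ}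
    (hC : ∀ β ∈ B, ∀ α ∈ A, 0 ≤ C β α) (hsum : ∀ α ∈ A, ∑ β ∈ B, C β α ≤ c α)
    (hnn : ∀ β ∈ B, ∀ x ∈ K, 0 ≤ signomial A (C β) x + c β * Real.exp (inner ℝ β x)) :
    (fun x => signomial A c x + signomial B c x) ∈ sageCone K A B := by
  classical
  obtain ⟨β₀, hβ₀⟩ := hB
  -- The slack in the positive coefficients is added to a single summand.
  set D : Vec n → Vec n → ℝ :=
    fun β α => C β α + if β = β₀ then c α - ∑ β' ∈ B, C β' α else 0 with hD
  have hCD : ∀ β, ∀ α ∈ A, C β α ≤ D β α := by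
    intro β α hα
    simp only [hD]
    split_ifs
    · linarith [hsum α hα]
    · linarith
  refine (Set.mem_finsetSum _ _ _).2
    ⟨fun β x => signomial A (D β) x + c β * Real.exp (inner ℝ β x), fun {β} hβ => ?_, ?_⟩
  · refine ⟨D β, c β, fun α hα => (hC β hβ α hα).trans (hCD β α hα), rfl, fun x hx => ?_⟩
    refine (hnn β hβ x hx).trans (add_le_add_left ?_ _)
    exact Finset.sum_le_sum fun α hα =>
      mul_le_mul_of_nonneg_right (hCD β α hα) (Real.exp_pos _).le
  · funext x
    simp only [Finset.sum_apply, Finset.sum_add_distrib, signomial]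
    congr 1
    rw [Finset.sum_comm]
    refine Finset.sum_congr rfl fun α _ => ?_
    rw [← Finset.sum_mul]
    simp [hD, Finset.sum_add_distrib, Finset.sum_ite_eq', hβ₀]

end Cone

/-! ### Entropy certificates for AGE signomials -/

section Entropy

variable {n : ℕ} {K : Set (Vec n)} {A : Finset (Vec n)} {β : Vec n} {γ ν : Vec n → ℝ} {b : ℝ}

/-- The relative entropy condition with real-valued terms: finiteness of the entropy is spelt out
as the absolute continuity of `ν` with respect to `γ`, and the bound on the support function
as a bound at every point. -/
def EntropyBound (K : Set (Vec n)) (A : Finset (Vec n)) (β : Vec n) (γ ν : Vec n → ℝ) (b : ℝ) :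
    Prop :=
  (∀ α ∈ A, γ α = 0 → ν α = 0) ∧
    ∀ x ∈ K, ∑ α ∈ A, ν α * Real.log (ν α / (Real.exp 1 * γ α)) -
      ∑ α ∈ A, ν α * inner ℝ (α - β) x ≤ b

lemma inner_neg_sum_smul_sub (ν : Vec n → ℝ) (x : Vec n) :
    inner ℝ (-∑ α ∈ A, ν α • (α - β)) x = -∑ α ∈ A, ν α * inner ℝ (α - β) x := by
  simp only [inner_neg_left, sum_inner, real_inner_smul_left]

lemma relEntropyTerm_ne_bot (a b : ℝ) : relEntropyTerm a b ≠ ⊥ := by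
  unfold relEntropyTerm
  split_ifs
  exacts [EReal.zero_ne_bot, top_ne_bot, EReal.coe_ne_bot _]

lemma relEntropy_ne_bot (A : Finset (Vec n)) (ν γ : Vec n → ℝ) : relEntropy A ν γ ≠ ⊥ :=
  Finset.sum_induction _ (· ≠ ⊥) (fun _ _ ha hb => by simp [EReal.add_eq_bot_iff, ha, hb])
    (by simp) fun _ _ => relEntropyTerm_ne_bot _ _

lemma relEntropy_eq_coe (h : ∀ α ∈ A, γ α = 0 → ν α = 0) :
    relEntropy A ν (fun α => Real.exp 1 * γ α) =
      ((∑ α ∈ A, ν α * Real.log (ν α / (Real.exp 1 * γ α)) : ℝ) : EReal) := by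
  have hcoe : ∀ g : Vec n → ℝ, ((∑ α ∈ A, g α : ℝ) : EReal) = ∑ α ∈ A, (g α : EReal) :=
    fun g => map_sum (⟨⟨Real.toEReal, EReal.coe_zero⟩, EReal.coe_add⟩ : ℝ →+ EReal) g A
  rw [hcoe, relEntropy]
  refine Finset.sum_congr rfl fun α hα => ?_
  unfold relEntropyTerm
  by_cases hν : ν α = 0
  · simp [hν]
  · have hγ : γ α ≠ 0 := fun h0 => hν (h α hα h0)
    simp [hν, hγ]

lemma eq_zero_of_relEntropy_ne_top
    (h : relEntropy A ν (fun α => Real.exp 1 * γ α) ≠ ⊤) : ∀ α ∈ A, γ α = 0 → ν α = 0 := by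
  classical
  intro α hα hγ
  by_contra hν
  apply h
  rw [relEntropy, ← Finset.add_sum_erase _ _ hα]
  simp only [relEntropyTerm, hν, hγ, mul_zero, if_true, if_false]
  exact EReal.top_add_of_ne_bot (relEntropy_ne_bot (A.erase α) ν fun α => Real.exp 1 * γ α)

lemma EntropyBound.entropy_le (h : EntropyBound K A β γ ν b) :
    relEntropy A ν (fun α => Real.exp 1 * γ α) + supportFn K (-∑ α ∈ A, ν α • (α - β)) ≤
      (b : EReal) := by
  rw [relEntropy_eq_coe h.1]
  set D := ∑ α ∈ A, ν α * Real.log (ν α / (Real.exp 1 * γ α)) with hD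
  have h1 : supportFn K (-∑ α ∈ A, ν α • (α - β)) ≤ ((b - D : ℝ) : EReal) := by
    refine iSup₂_le fun x hx => EReal.coe_le_coe_iff.2 ?_
    rw [inner_neg_sum_smul_sub]
    linarith [h.2 x hx]
  refine (add_le_add_right h1 _).trans ?_
  rw [← EReal.coe_add]
  exact EReal.coe_le_coe_iff.2 (by linarith)

/-- Over an empty `K` the support function is `⊥` and the extended-real condition is void, even
without absolute continuity; hence the nonemptiness hypothesis. -/
lemma entropyBound_of_entropy_le (hK : K.Nonempty)
    (h : relEntropy A ν (fun α => Real.exp 1 * γ α) + supportFn K (-∑ α ∈ A, ν α • (α - β)) ≤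
      (b : EReal)) : EntropyBound K A β γ ν b := by
  have h1 : ∀ x ∈ K, relEntropy A ν (fun α => Real.exp 1 * γ α) +
      ((-∑ α ∈ A, ν α * inner ℝ (α - β) x : ℝ) : EReal) ≤ (b : EReal) := by
    intro x hx
    rw [← inner_neg_sum_smul_sub]
    exact (add_le_add_right (le_iSup₂ (f := fun y (_ : y ∈ K) =>
      ((inner ℝ (-∑ α ∈ A, ν α • (α - β)) y : ℝ) : EReal)) x hx) _).trans h
  obtain ⟨x₀, hx₀⟩ := hK
  have h2 : ∀ α ∈ A, γ α = 0 → ν α = 0 := by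
    refine eq_zero_of_relEntropy_ne_top fun htop => ?_
    have := h1 x₀ hx₀
    rw [htop, EReal.top_add_coe, top_le_iff] at this
    exact EReal.coe_ne_top _ this
  refine ⟨h2, fun x hx => ?_⟩
  have := h1 x hx
  rw [relEntropy_eq_coe h2, ← EReal.coe_add, EReal.coe_le_coe_iff] at this
  linarith

lemma signomial_add_eq_mul (x : Vec n) :
    signomial A γ x + b * Real.exp (inner ℝ β x) =
      Real.exp (inner ℝ β x) * (∑ α ∈ A, γ α * Real.exp (inner ℝ (α - β) x) + b) := by
  rw [mul_add, Finset.mul_sum, mul_comm b, signomial]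
  congr 1
  refine Finset.sum_congr rfl fun α _ => ?_
  rw [mul_left_comm, ← Real.exp_add, inner_sub_left, add_sub_cancel]

/-- Weak duality: an entropy bound certifies nonnegativity on `K`. -/
lemma EntropyBound.nonneg (h : EntropyBound K A β γ ν b) (hγ : ∀ α ∈ A, 0 ≤ γ α)
    (hν : ∀ α ∈ A, 0 ≤ ν α) {x : Vec n} (hx : x ∈ K) :
    0 ≤ signomial A γ x + b * Real.exp (inner ℝ β x) := by
  rw [signomial_add_eq_mul]
  refine mul_nonneg (Real.exp_pos _).le ?_
  have h1 := h.2 x hx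
  have h2 : ∑ α ∈ A, (ν α * inner ℝ (α - β) x - ν α * Real.log (ν α / (Real.exp 1 * γ α))) ≤
      ∑ α ∈ A, γ α * Real.exp (inner ℝ (α - β) x) :=
    Finset.sum_le_sum fun α hα => mul_sub_mul_log_div_le_mul_exp (hγ α hα) (hν α hα) (h.1 α hα)
  rw [Finset.sum_sub_distrib] at h2
  linarith

/-- Strong duality: every AGE signomial has an entropy bound. -/
lemma exists_entropyBound (hK : Convex ℝ K) (hγ : ∀ α ∈ A, 0 ≤ γ α)
    (h : ∀ x ∈ K, 0 ≤ signomial A γ x + b * Real.exp (inner ℝ β x)) :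
    ∃ ν : Vec n → ℝ, (∀ α ∈ A, 0 ≤ ν α) ∧ EntropyBound K A β γ ν b := by
  classical
  rcases K.eq_empty_or_nonempty with rfl | hne
  · exact ⟨0, fun _ _ => le_rfl, fun _ _ _ => rfl, fun x hx => hx.elim⟩
  set L : Vec n → A → ℝ := fun x α => inner ℝ ((α : Vec n) - β) x with hL
  have hLlin : IsLinearMap ℝ L :=
    ⟨fun x y => by funext α; simp [hL, inner_add_right],
      fun r x => by funext α; simp [hL, real_inner_smul_right]⟩
  obtain ⟨ν, h1, h2, h3⟩ := exists_entropy_certificate (c := fun α : A => γ α) (b := b)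
    (fun α => hγ α α.2) (hK.is_linear_image hLlin) (hne.image L) (by
      rintro _ ⟨x, hx, rfl⟩
      have := h x hx
      rw [signomial_add_eq_mul] at this
      rw [Finset.sum_coe_sort A fun α => γ α * Real.exp (inner ℝ (α - β) x)]
      exact nonneg_of_mul_nonneg_right this (Real.exp_pos _))
  obtain ⟨ν', rfl⟩ : ∃ ν' : Vec n → ℝ, ν = fun α : A => ν' α :=
    ⟨fun α => if hα : α ∈ A then ν ⟨α, hα⟩ else 0, by funext α; simp⟩
  refine ⟨ν', fun α hα => h1 ⟨α, hα⟩, fun α hα => h2 ⟨α, hα⟩, fun x hx => ?_⟩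
  have := h3 (L x) ⟨x, hx, rfl⟩
  rwa [Finset.sum_coe_sort A fun α => ν' α * Real.log (ν' α / (Real.exp 1 * γ α)),
    Finset.sum_coe_sort A fun α => ν' α * inner ℝ (α - β) x] at this

end Entropy

/-! ### The dual action, orbits and cosets -/

section Action

variable {n : ℕ} {G : Type*} [Group G] {φ : Representation ℝ G (Vec n)}

lemma inner_dualAct (σ : G) (α x : Vec n) :
    inner ℝ (dualAct φ σ α) x = inner ℝ α (φ σ⁻¹ x) :=
  LinearMap.adjoint_inner_left _ _ _

lemma dualAct_mul (σ τ : G) (α : Vec n) :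
    dualAct φ (σ * τ) α = dualAct φ σ (dualAct φ τ α) := by
  rw [map_mul, Module.End.mul_apply]

@[simp]
lemma dualAct_one (α : Vec n) : dualAct φ 1 α = α := by
  rw [map_one, Module.End.one_apply]

@[simp]
lemma dualAct_inv_dualAct (σ : G) (α : Vec n) : dualAct φ σ⁻¹ (dualAct φ σ α) = α := by
  rw [← dualAct_mul, inv_mul_cancel, dualAct_one]

@[simp]
lemma dualAct_dualAct_inv (σ : G) (α : Vec n) : dualAct φ σ (dualAct φ σ⁻¹ α) = α := by
  rw [← dualAct_mul, mul_inv_cancel, dualAct_one]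

lemma mem_stab {σ : G} {β : Vec n} : σ ∈ stab φ β ↔ dualAct φ σ β = β := Iff.rfl

/-- Reindexing a sum over an invariant set of exponents. -/
lemma sum_dualAct {A : Finset (Vec n)} (hA : ∀ (σ : G), ∀ α ∈ A, dualAct φ σ α ∈ A) (σ : G)
    (g : Vec n → ℝ) : ∑ α ∈ A, g (dualAct φ σ α) = ∑ α ∈ A, g α :=
  Finset.sum_nbij' (dualAct φ σ) (dualAct φ σ⁻¹) (fun α hα => hA σ α hα)
    (fun α hα => hA σ⁻¹ α hα) (by simp) (by simp) (by simp)

lemma signomial_comp_dualAct {A : Finset (Vec n)}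
    (hA : ∀ (σ : G), ∀ α ∈ A, dualAct φ σ α ∈ A) (σ : G) (c : Vec n → ℝ) (x : Vec n) :
    signomial A (fun α => c (dualAct φ σ α)) x = signomial A c (φ σ x) := by
  rw [signomial, signomial, ← sum_dualAct hA σ fun α => c α * Real.exp (inner ℝ α (φ σ x))]
  refine Finset.sum_congr rfl fun α _ => ?_
  rw [inner_dualAct, ← Module.End.mul_apply, ← map_mul, inv_mul_cancel, map_one,
    Module.End.one_apply]

/-- The coefficients of an invariant signomial, extended by zero off the support, are
invariant. -/
lemma extend_coeff_dualAct [DecidableEq (Vec n)] {T : Finset (Vec n)} {c : Vec n → ℝ} {σ : G}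
    (h : ∀ x, signomial T c (φ σ⁻¹ x) = signomial T c x) (α : Vec n) (hα : α ∈ T) :
    (if dualAct φ σ α ∈ T then c (dualAct φ σ α) else 0) = c α := by
  set S := T.image (dualAct φ σ) with hS
  have hsum : ∀ x, signomial (T ∪ S) (fun α => if α ∈ T then c α else 0) x =
      signomial (T ∪ S) (fun α => if α ∈ S then c (dualAct φ σ⁻¹ α) else 0) x := by
    intro x
    have h1 : signomial (T ∪ S) (fun α => if α ∈ T then c α else 0) x = signomial T c x := by
      simp only [signomial, ite_mul, zero_mul]
      rw [Finset.sum_ite_mem, Finset.union_inter_cancel_left]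
    have h2 : signomial (T ∪ S) (fun α => if α ∈ S then c (dualAct φ σ⁻¹ α) else 0) x =
        signomial T c (φ σ⁻¹ x) := by
      simp only [signomial, ite_mul, zero_mul]
      rw [Finset.sum_ite_mem, Finset.union_inter_cancel_right, hS, Finset.sum_image]
      · simp [inner_dualAct]
      · intro a _ b _ hab
        simpa using congrArg (dualAct φ σ⁻¹) hab
    rw [h1, h2, h]
  have hS' : dualAct φ σ α ∈ S := Finset.mem_image_of_mem _ hα
  simpa [hS'] using signomial_coeff_unique hsum _ (Finset.mem_union_right _ hS')

/-- An invariant signomial has invariant sets of exponents with positive and with negative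
coefficients, and invariant coefficients. -/
lemma coeff_invariant {A B : Finset (Vec n)} {c : Vec n → ℝ} (hcA : ∀ α ∈ A, 0 < c α)
    (hcB : ∀ β ∈ B, c β < 0) (h : ∀ (σ : G) x, signomial A c (φ σ⁻¹ x) + signomial B c (φ σ⁻¹ x) =
      signomial A c x + signomial B c x) :
    (∀ (σ : G), ∀ α ∈ A, dualAct φ σ α ∈ A ∧ c (dualAct φ σ α) = c α) ∧
      ∀ (σ : G), ∀ β ∈ B, dualAct φ σ β ∈ B ∧ c (dualAct φ σ β) = c β := by
  classical
  have hAB : Disjoint A B :=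
    Finset.disjoint_left.2 fun α h1 h2 => (hcA α h1).not_gt (hcB α h2)
  simp only [signomial_add_signomial hAB, ite_self] at h
  have key : ∀ (σ : G), ∀ α ∈ A ∪ B, c α ≠ 0 →
      dualAct φ σ α ∈ A ∪ B ∧ c (dualAct φ σ α) = c α := by
    intro σ α hα h0
    have h1 := extend_coeff_dualAct (h σ) α hα
    split_ifs at h1 with h2
    · exact ⟨h2, h1⟩
    · exact absurd h1.symm h0
  refine ⟨fun σ α hα => ?_, fun σ β hβ => ?_⟩
  · obtain ⟨h1, h2⟩ := key σ α (Finset.mem_union_left _ hα) (hcA α hα).ne'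
    refine ⟨(Finset.mem_union.1 h1).resolve_right fun h3 => ?_, h2⟩
    linarith [hcA α hα, hcB _ h3]
  · obtain ⟨h1, h2⟩ := key σ β (Finset.mem_union_right _ hβ) (hcB β hβ).ne
    refine ⟨(Finset.mem_union.1 h1).resolve_left fun h3 => ?_, h2⟩
    linarith [hcB β hβ, hcA _ h3]

/-- Distinct orbit representatives lie in distinct orbits. -/
lemma eq_of_dualAct_eq {S Shat : Set (Vec n)} (h : IsOrbitReps φ S Shat) {β β' : Vec n}
    (hβ : β ∈ Shat) (hβ' : β' ∈ Shat) {σ : G} (hσ : dualAct φ σ β = β') : β = β' := by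
  by_contra hne
  -- Otherwise `β'` could be dropped from the set of representatives.
  have hsub : Shat \ {β'} ⊆ S ∧ orbitSet φ (Shat \ {β'}) = S := by
    refine ⟨Set.sdiff_subset.trans h.prop.1, ?_⟩
    rw [← h.prop.2]
    ext α
    constructor
    · rintro ⟨τ, s, hs, rfl⟩
      exact ⟨τ, s, hs.1, rfl⟩
    · rintro ⟨τ, s, hs, rfl⟩
      by_cases hs' : s = β'
      · exact ⟨τ * σ, β, ⟨hβ, hne⟩, by rw [dualAct_mul, hσ, hs']⟩
      · exact ⟨τ, s, ⟨hs, hs'⟩, rfl⟩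
  exact (h.le_of_le hsub Set.sdiff_subset hβ').2 rfl

variable {B Bhat : Finset (Vec n)} {R : Vec n → Finset G}

/-- Every exponent in `B` is `σ⁻¹ β` for a unique representative `β` and a unique `σ ∈ R β`: right
cosets of the stabilizer correspond to points of the orbit through `σ ↦ σ⁻¹ β`. -/
lemma existsUnique_coset_rep
    (hBhat : IsOrbitReps φ (B : Set (Vec n)) (Bhat : Set (Vec n)))
    (hR : ∀ β ∈ Bhat, Subgroup.IsComplement (stab φ β : Set G) (R β : Set G)) :
    ∀ β ∈ B, ∃! p : Vec n × G, p.1 ∈ Bhat ∧ p.2 ∈ R p.1 ∧ dualAct φ p.2⁻¹ p.1 = β := by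
  intro β hβ
  have hβ' : β ∈ orbitSet φ (Bhat : Set (Vec n)) := by rw [hBhat.prop.2]; exact hβ
  obtain ⟨g, βhat, hhat, rfl⟩ := hβ'
  obtain ⟨⟨⟨s, hs⟩, ⟨r, hr⟩⟩, hsr, -⟩ := (hR βhat hhat).existsUnique g⁻¹
  have hg : g = r⁻¹ * s⁻¹ := by
    rw [← mul_inv_rev]
    exact eq_inv_of_mul_eq_one_right (by rw [hsr, inv_mul_cancel])
  have hs' : dualAct φ s⁻¹ βhat = βhat := (stab φ βhat).inv_mem hs
  have hrg : dualAct φ r⁻¹ βhat = dualAct φ g βhat := by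
    rw [hg, dualAct_mul, hs']
  refine ⟨(βhat, r), ⟨hhat, hr, hrg⟩, ?_⟩
  rintro ⟨β', τ⟩ ⟨h1, h2, h3⟩
  dsimp only at h1 h2 h3
  rw [← hrg] at h3
  have h4 : dualAct φ (r * τ⁻¹) β' = βhat := by rw [dualAct_mul, h3, dualAct_dualAct_inv]
  obtain rfl := eq_of_dualAct_eq hBhat h1 hhat h4
  have h5 := ((hR β' h1).existsUnique r).unique (y₁ := ⟨⟨r * τ⁻¹, h4⟩, ⟨τ, h2⟩⟩)
    (y₂ := ⟨⟨1, (stab φ β').one_mem⟩, ⟨r, hr⟩⟩) (by simp) (by simp)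
  have h6 : τ = r := congrArg (fun p => (p.2 : G)) h5
  rw [h6]

/-- The pairs of an orbit representative and a coset representative enumerate `B`. -/
lemma sum_coset_reps
    (hBhat : IsOrbitReps φ (B : Set (Vec n)) (Bhat : Set (Vec n)))
    (hR : ∀ β ∈ Bhat, Subgroup.IsComplement (stab φ β : Set G) (R β : Set G))
    (F : Vec n → ℝ) :
    ∑ β ∈ Bhat, ∑ σ ∈ R β, F (dualAct φ σ⁻¹ β) = ∑ β ∈ B, F β := by
  have hmem : ∀ β ∈ Bhat, ∀ σ : G, dualAct φ σ β ∈ B := by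
    intro β hβ σ
    rw [← Finset.mem_coe, ← hBhat.prop.2]
    exact ⟨σ, β, hβ, rfl⟩
  have hex := existsUnique_coset_rep hBhat hR
  rw [Finset.sum_sigma']
  refine Finset.sum_bij (fun p _ => dualAct φ p.2⁻¹ p.1) ?_ ?_ ?_ fun _ _ => rfl
  · rintro ⟨β, σ⟩ h
    exact hmem _ (Finset.mem_sigma.1 h).1 _
  · rintro ⟨β, σ⟩ h ⟨β', σ'⟩ h' heq
    have h1 := Finset.mem_sigma.1 h
    have h2 := Finset.mem_sigma.1 h'
    have h3 := (hex _ (hmem _ h1.1 σ⁻¹)).unique (y₁ := (β, σ)) (y₂ := (β', σ'))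
      ⟨h1.1, h1.2, rfl⟩ ⟨h2.1, h2.2, heq.symm⟩
    obtain ⟨rfl, rfl⟩ := Prod.ext_iff.1 h3
    rfl
  · intro β hβ
    obtain ⟨⟨β', σ⟩, ⟨h1, h2, h3⟩, -⟩ := hex β hβ
    exact ⟨⟨β', σ⟩, Finset.mem_sigma.2 ⟨h1, h2⟩, h3⟩

end Action

/-! ### Averaging certificates over the group -/

section Averaging

variable {n : ℕ} {G : Type*} [Group G] {φ : Representation ℝ G (Vec n)}
  {K : Set (Vec n)} {A B Bhat : Finset (Vec n)} {c : Vec n → ℝ}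

/-- Averaging the coefficients of a decomposition over the group yields an equivariant
decomposition. -/
lemma exists_equivariant_coeff [Finite G] (hKG : ∀ (σ : G), ∀ x ∈ K, φ σ x ∈ K)
    (hA : ∀ (σ : G), ∀ α ∈ A, dualAct φ σ α ∈ A ∧ c (dualAct φ σ α) = c α)
    (hB : ∀ (σ : G), ∀ β ∈ B, dualAct φ σ β ∈ B ∧ c (dualAct φ σ β) = c β)
    {C : Vec n → Vec n → ℝ} (hC : ∀ β ∈ B, ∀ α ∈ A, 0 ≤ C β α)
    (hsum : ∀ α ∈ A, ∑ β ∈ B, C β α = c α)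
    (hnn : ∀ β ∈ B, ∀ x ∈ K, 0 ≤ signomial A (C β) x + c β * Real.exp (inner ℝ β x)) :
    ∃ D : Vec n → Vec n → ℝ, (∀ (σ : G) β α, D (dualAct φ σ β) (dualAct φ σ α) = D β α) ∧
      (∀ β ∈ B, ∀ α ∈ A, 0 ≤ D β α) ∧ (∀ α ∈ A, ∑ β ∈ B, D β α = c α) ∧
      ∀ β ∈ B, ∀ x ∈ K, 0 ≤ signomial A (D β) x + c β * Real.exp (inner ℝ β x) := by
  have := Fintype.ofFinite G
  have hcard : (0 : ℝ) < Fintype.card G := by exact_mod_cast Fintype.card_pos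
  refine ⟨fun β α => (Fintype.card G : ℝ)⁻¹ * ∑ σ : G, C (dualAct φ σ β) (dualAct φ σ α),
    fun τ β α => ?_, fun β hβ α hα => ?_, fun α hα => ?_, fun β hβ x hx => ?_⟩
  · dsimp only
    congr 1
    simp only [← dualAct_mul]
    exact Equiv.sum_comp (Equiv.mulRight τ) fun σ => C (dualAct φ σ β) (dualAct φ σ α)
  · exact mul_nonneg (by positivity) (Finset.sum_nonneg fun σ _ =>
      hC _ (hB σ β hβ).1 _ (hA σ α hα).1)
  · rw [← Finset.mul_sum, Finset.sum_comm]
    have h1 : ∀ σ : G, ∑ β ∈ B, C (dualAct φ σ β) (dualAct φ σ α) = c α := by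
      intro σ
      rw [sum_dualAct (fun σ β hβ => (hB σ β hβ).1) σ fun β => C β (dualAct φ σ α),
        hsum _ (hA σ α hα).1, (hA σ α hα).2]
    simp only [h1, Finset.sum_const, Finset.card_univ, nsmul_eq_mul]
    field_simp
  · have h1 : ∀ σ : G, 0 ≤ signomial A (fun α => C (dualAct φ σ β) (dualAct φ σ α)) x +
        c β * Real.exp (inner ℝ β x) := by
      intro σ
      rw [signomial_comp_dualAct (fun σ α hα => (hA σ α hα).1) σ (C (dualAct φ σ β))]
      have h2 := hnn _ (hB σ β hβ).1 _ (hKG σ x hx)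
      rwa [(hB σ β hβ).2, inner_dualAct, ← Module.End.mul_apply, ← map_mul, inv_mul_cancel,
        map_one, Module.End.one_apply] at h2
    have h3 : signomial A (fun α => (Fintype.card G : ℝ)⁻¹ *
        ∑ σ : G, C (dualAct φ σ β) (dualAct φ σ α)) x + c β * Real.exp (inner ℝ β x) =
        (Fintype.card G : ℝ)⁻¹ * ∑ σ : G,
          (signomial A (fun α => C (dualAct φ σ β) (dualAct φ σ α)) x +
            c β * Real.exp (inner ℝ β x)) := by
      rw [Finset.sum_add_distrib, mul_add]
      simp only [signomial, Finset.sum_const, Finset.card_univ, nsmul_eq_mul]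
      congr 1
      · rw [Finset.sum_comm, Finset.mul_sum]
        exact Finset.sum_congr rfl fun α _ => by rw [← Finset.sum_mul, mul_assoc]
      · field_simp
    rw [h3]
    exact mul_nonneg (by positivity) (Finset.sum_nonneg fun σ _ => h1 σ)

/-- By convexity of the entropy and of the support function in `ν`, the weights of an entropy bound
can be averaged over the stabilizer, which fixes `γ` and preserves `K`. -/
lemma exists_stab_invariant_weight [Finite G] (hKG : ∀ (σ : G), ∀ x ∈ K, φ σ x ∈ K)
    (hA : ∀ (σ : G), ∀ α ∈ A, dualAct φ σ α ∈ A) {β : Vec n} {γ ν : Vec n → ℝ} {b : ℝ}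
    (hγ : ∀ τ ∈ stab φ β, ∀ α, γ (dualAct φ τ α) = γ α) (hν : ∀ α ∈ A, 0 ≤ ν α)
    (h : EntropyBound K A β γ ν b) :
    ∃ μ : Vec n → ℝ, (∀ τ ∈ stab φ β, ∀ α, μ (dualAct φ τ α) = μ α) ∧ (∀ α ∈ A, 0 ≤ μ α) ∧
      EntropyBound K A β γ μ b := by
  have := Fintype.ofFinite (stab φ β)
  set w : ℝ := (Fintype.card (stab φ β) : ℝ)⁻¹ with hw
  have hcard : (0 : ℝ) < Fintype.card (stab φ β) := by exact_mod_cast Fintype.card_pos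
  have hw0 : 0 ≤ w := by positivity
  have hw1 : ∑ _τ : stab φ β, w = 1 := by
    rw [Finset.sum_const, Finset.card_univ, nsmul_eq_mul, hw, mul_inv_cancel₀ hcard.ne']
  refine ⟨fun α => ∑ τ : stab φ β, w * ν (dualAct φ (τ : G) α), fun τ hτ α => ?_, fun α hα => ?_,
    fun α hα h0 => ?_, fun x hx => ?_⟩
  · simp only [← dualAct_mul]
    exact Equiv.sum_comp (Equiv.mulRight (⟨τ, hτ⟩ : stab φ β)) fun σ : stab φ β =>
      w * ν (dualAct φ (σ : G) α)
  · exact Finset.sum_nonneg fun τ _ => mul_nonneg hw0 (hν _ (hA τ α hα))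
  · refine Finset.sum_eq_zero fun τ _ => ?_
    rw [h.1 _ (hA τ α hα) (by rw [hγ τ τ.2, h0]), mul_zero]
  · have h1 : ∀ α ∈ A, (∑ τ : stab φ β, w * ν (dualAct φ (τ : G) α)) *
        Real.log ((∑ τ : stab φ β, w * ν (dualAct φ (τ : G) α)) / (Real.exp 1 * γ α)) ≤
        ∑ τ : stab φ β, w * (ν (dualAct φ (τ : G) α) *
          Real.log (ν (dualAct φ (τ : G) α) / (Real.exp 1 * γ (dualAct φ (τ : G) α)))) := by
      intro α hα
      have := (convexOn_mul_log_div (Real.exp 1 * γ α)).map_sum_le (t := Finset.univ)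
        (w := fun _ : stab φ β => w) (p := fun τ : stab φ β => ν (dualAct φ (τ : G) α))
        (fun _ _ => hw0) hw1 fun τ _ => hν _ (hA τ α hα)
      simp only [smul_eq_mul] at this
      refine this.trans_eq (Finset.sum_congr rfl fun τ _ => ?_)
      rw [hγ τ τ.2]
    have h2 : ∀ τ : stab φ β, ∑ α ∈ A, ν (dualAct φ (τ : G) α) * inner ℝ (α - β) x =
        ∑ α ∈ A, ν α * inner ℝ (α - β) (φ (τ : G) x) := by
      intro τ
      rw [← sum_dualAct hA (τ : G) fun α => ν α * inner ℝ (α - β) (φ (τ : G) x)]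
      refine Finset.sum_congr rfl fun α _ => ?_
      have h3 : dualAct φ (τ : G) α - β = dualAct φ (τ : G) (α - β) := by
        rw [map_sub, mem_stab.1 τ.2]
      rw [h3, inner_dualAct, ← Module.End.mul_apply, ← map_mul, inv_mul_cancel, map_one,
        Module.End.one_apply]
    have h4 : ∑ α ∈ A, (∑ τ : stab φ β, w * ν (dualAct φ (τ : G) α)) * inner ℝ (α - β) x =
        ∑ τ : stab φ β, w * ∑ α ∈ A, ν α * inner ℝ (α - β) (φ (τ : G) x) := by
      simp only [← h2, Finset.sum_mul, Finset.mul_sum, mul_assoc]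
      rw [Finset.sum_comm]
    have h5 : ∑ α ∈ A, ∑ τ : stab φ β, w * (ν (dualAct φ (τ : G) α) *
          Real.log (ν (dualAct φ (τ : G) α) / (Real.exp 1 * γ (dualAct φ (τ : G) α)))) =
        ∑ _τ : stab φ β, w * ∑ α ∈ A, ν α * Real.log (ν α / (Real.exp 1 * γ α)) := by
      rw [Finset.sum_comm]
      refine Finset.sum_congr rfl fun τ _ => ?_
      rw [← Finset.mul_sum,
        sum_dualAct hA (τ : G) fun α => ν α * Real.log (ν α / (Real.exp 1 * γ α))]
    rw [h4]
    refine (sub_le_sub_right ((Finset.sum_le_sum h1).trans_eq h5) _).trans ?_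
    rw [← Finset.sum_sub_distrib]
    calc _ ≤ ∑ _τ : stab φ β, w * b := Finset.sum_le_sum fun τ _ => by
          rw [← mul_sub]
          exact mul_le_mul_of_nonneg_left (h.2 _ (hKG τ x hx)) hw0
      _ = b := by rw [← Finset.sum_mul, hw1, one_mul]

variable {R : Vec n → Finset G}

/-- The rows of an equivariant decomposition at the orbit representatives, with averaged weights,
form a certificate. -/
lemma exists_invariant_certificate [Finite G] (hK : Convex ℝ K)
    (hKG : ∀ (σ : G), ∀ x ∈ K, φ σ x ∈ K)
    (hBhat : IsOrbitReps φ (B : Set (Vec n)) (Bhat : Set (Vec n)))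
    (hAB : Disjoint A B)
    (hA : ∀ (σ : G), ∀ α ∈ A, dualAct φ σ α ∈ A ∧ c (dualAct φ σ α) = c α)
    (hB : ∀ (σ : G), ∀ β ∈ B, dualAct φ σ β ∈ B ∧ c (dualAct φ σ β) = c β)
    (hR : ∀ β ∈ Bhat, Subgroup.IsComplement (stab φ β : Set G) (R β : Set G))
    (h : (fun x => signomial A c x + signomial B c x) ∈ sageCone K A B) :
    ∃ γ ν : Vec n → Vec n → ℝ, IsCertificate φ K A Bhat c R γ ν ∧
      IsStabInvariant φ A Bhat γ ν := by
  obtain ⟨C, hC, hsum, hnn⟩ := exists_coeff_of_mem_sageCone hAB h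
  obtain ⟨D, hDG, hD, hDsum, hDnn⟩ := exists_equivariant_coeff hKG hA hB hC hsum hnn
  have hDstab : ∀ β, ∀ τ ∈ stab φ β, ∀ α, D β (dualAct φ τ α) = D β α := by
    intro β τ hτ α
    conv_lhs => rw [← mem_stab.1 hτ]
    exact hDG τ β α
  have hsub : ∀ β ∈ Bhat, β ∈ B := fun β hβ => hBhat.prop.1 hβ
  have hex : ∀ β ∈ Bhat, ∃ μ : Vec n → ℝ, (∀ τ ∈ stab φ β, ∀ α, μ (dualAct φ τ α) = μ α) ∧
      (∀ α ∈ A, 0 ≤ μ α) ∧ EntropyBound K A β (D β) μ (c β) := by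
    intro β hβ
    obtain ⟨ν, h1, h2⟩ := exists_entropyBound hK (hD β (hsub β hβ)) (hDnn β (hsub β hβ))
    exact exists_stab_invariant_weight hKG (fun σ α hα => (hA σ α hα).1) (hDstab β) h1 h2
  choose! ν h1 h2 h3 using hex
  refine ⟨D, ν, ⟨fun β hβ => hD β (hsub β hβ), h2, fun β hβ => (h3 β hβ).entropy_le,
    fun α hα => ?_⟩, fun β hβ τ hτ α _ => ⟨hDstab β τ hτ α, h1 β hβ τ hτ α⟩⟩
  rw [← hDsum α hα, ← sum_coset_reps hBhat hR fun β => D β α]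
  refine le_of_eq (Finset.sum_congr rfl fun β _ => Finset.sum_congr rfl fun σ _ => ?_)
  rw [← hDG σ (dualAct φ σ⁻¹ β), dualAct_dualAct_inv]

/-- A certificate on orbit representatives is transported to all of `B` by the group. -/
lemma mem_sageCone_of_certificate (hKG : ∀ (σ : G), ∀ x ∈ K, φ σ x ∈ K) (hBne : B.Nonempty)
    (hBhat : IsOrbitReps φ (B : Set (Vec n)) (Bhat : Set (Vec n)))
    (hA : ∀ (σ : G), ∀ α ∈ A, dualAct φ σ α ∈ A ∧ c (dualAct φ σ α) = c α)
    (hB : ∀ (σ : G), ∀ β ∈ B, dualAct φ σ β ∈ B ∧ c (dualAct φ σ β) = c β)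
    (hR : ∀ β ∈ Bhat, Subgroup.IsComplement (stab φ β : Set G) (R β : Set G))
    {γ ν : Vec n → Vec n → ℝ} (h : IsCertificate φ K A Bhat c R γ ν) :
    (fun x => signomial A c x + signomial B c x) ∈ sageCone K A B := by
  have hex := existsUnique_coset_rep hBhat hR
  choose! p hp huniq using hex
  refine mem_sageCone_of_coeff hBne (C := fun β α => γ (p β).1 (dualAct φ (p β).2 α))
    (fun β hβ α hα => h.nonneg_coeff _ (hp β hβ).1 _ (hA _ α hα).1) (fun α hα => ?_)
    fun β hβ x hx => ?_
  · rw [← sum_coset_reps hBhat hR]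
    refine (Finset.sum_le_sum fun β hβ => Finset.sum_le_sum fun σ hσ => ?_).trans
      (h.coeff_le α hα)
    have h1 : (β, σ) = p (dualAct φ σ⁻¹ β) :=
      huniq _ (hB σ⁻¹ β (hBhat.prop.1 hβ)).1 _ ⟨hβ, hσ, rfl⟩
    rw [← h1]
  · obtain ⟨h1, -, h3⟩ := hp β hβ
    rw [signomial_comp_dualAct (fun σ α hα => (hA σ α hα).1) (p β).2 (γ (p β).1)]
    have h4 := (entropyBound_of_entropy_le ⟨x, hx⟩ (h.entropy_le _ h1)).nonneg
      (h.nonneg_coeff _ h1) (h.nonneg_weight _ h1) (hKG (p β).2 x hx)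
    have h5 : c β = c (p β).1 := by
      conv_lhs => rw [← h3]
      exact (hB _ _ (hBhat.prop.1 h1)).2
    have h6 : inner ℝ β x = inner ℝ (p β).1 (φ (p β).2 x) := by
      conv_lhs => rw [← h3, inner_dualAct, inv_inv]
    rwa [h5, h6]

end Averaging

end SymmSage

theorem mainTheorem7 {n : ℕ} {G : Type*} [Group G] [Finite G]
    (φ : Representation ℝ G (SymmSage.Vec n))
    (K : Set (SymmSage.Vec n)) (hK : Convex ℝ K) (hKG : ∀ σ : G, ∀ x ∈ K, φ σ x ∈ K)
    (A B Bhat : Finset (SymmSage.Vec n)) (hB : B.Nonempty)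
    (hBhat : SymmSage.IsOrbitReps φ (B : Set (SymmSage.Vec n)) (Bhat : Set (SymmSage.Vec n)))
    (c : SymmSage.Vec n → ℝ) (hcA : ∀ α ∈ A, 0 < c α) (hcB : ∀ β ∈ B, c β < 0)
    (f : SymmSage.Vec n → ℝ)
    (hf : f = fun x => SymmSage.signomial A c x + SymmSage.signomial B c x)
    (hfG : ∀ σ : G, ∀ x, f (φ σ⁻¹ x) = f x)
    (R : SymmSage.Vec n → Finset G)
    (hR : ∀ β ∈ Bhat,
      Subgroup.IsComplement (SymmSage.stab φ β : Set G) (R β : Set G)) :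
    (f ∈ SymmSage.sageCone K A B ↔
      ∃ γ ν : SymmSage.Vec n → SymmSage.Vec n → ℝ,
        SymmSage.IsCertificate φ K A Bhat c R γ ν) ∧
    (f ∈ SymmSage.sageCone K A B →
      ∃ γ ν : SymmSage.Vec n → SymmSage.Vec n → ℝ,
        SymmSage.IsCertificate φ K A Bhat c R γ ν ∧
        SymmSage.IsStabInvariant φ A Bhat γ ν) := by
  subst hf
  have hAB : Disjoint A B :=
    Finset.disjoint_left.2 fun α h1 h2 => (hcA α h1).not_gt (hcB α h2)
  obtain ⟨hA, hBinv⟩ := SymmSage.coeff_invariant hcA hcB hfG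
  have key := fun h => SymmSage.exists_invariant_certificate hK hKG hBhat hAB hA hBinv hR h
  refine ⟨⟨fun h => ?_, ?_⟩, key⟩
  · obtain ⟨γ, ν, h1, -⟩ := key h
    exact ⟨γ, ν, h1⟩
  · rintro ⟨γ, ν, h⟩
    exact SymmSage.mem_sageCone_of_certificate hKG hB hBhat hA hBinv hR h
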